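/- Let $(\varphi_e)_{e\in\mathbb N}$ be a standard numbering of the partial computable functions and $W_e=\operatorname{dom}\varphi_e$ the $e$-th c.e. set. Consider the signature with exactly two function symbols $f,g$, both unary, and let $T(x_0)$ be the set of terms over the single generator $x_0$. Fix a computable bijective coding of pairs of terms by natural numbers, and for $e\in\mathbb N$ let $A_e=\langle x_0\mid W_e\rangle$ be the quotient of the term algebra $T(x_0)$ by the smallest congruence relation containing all pairs $(s,t)$ whose code lies in $W_e$; thus $(A_e)_{e\in\mathbb N}$ lists all $1$-generated c.e. algebras with two unary function symbols. For $e,i\in\mathbb N$ put $e\cong i$ if and only if the algebras $A_e$ and $A_i$ are isomorphic. For equivalence relations $E,F$ on $\mathbb N$, say that $E$ is computably reducible to $F$ ($E\le_c F$) if there is a computable function $h:\mathbb N\to\mathbb N$ such that for all $x,y\in\mathbb N$: $x\mathrel{E}y \iff h(x)\mathrel{F}h(y)$. Theorem. The relation $\cong$ on $\mathbb N$ is a $\Sigma^0_3$-complete equivalence relation under computable reducibility: it is an equivalence relation, it is $\Sigma^0_3$ as a subset of $\mathbb N\times\mathbb N$, and every $\Sigma^0_3$ equivalence relation $F$ on $\mathbb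 N$ satisfies $F\le_c{\cong}$. -/

import Mathlib

namespace CeAlg

open FirstOrder FirstOrder.Language

/-! ### Computability -/

/-- The `e`-th c.e. set `W e`: the domain of the `e`-th partial computable function. -/
def W (e : ℕ) : Set ℕ :=
  {x | (Nat.Partrec.Code.eval (Denumerable.ofNat Nat.Partrec.Code e) x).Dom}

/-- `Σ⁰₃` predicates: `P x ↔ ∃ a, ∀ b, ∃ c, R (x, a, b, c)` for some computable predicate `R`. -/
def SigmaZeroThree {α : Type} [Primcodable α] (P : α → Prop) : Prop :=
  ∃ R : α × ℕ × ℕ × ℕ → Prop, ComputablePred R ∧ ∀ x, P x ↔ ∃ a, ∀ b, ∃ c, R (x, a, b, c)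

/-- Computable reducibility `E ≤_c F` of relations on `ℕ`. -/
def ComputablyReducible (E F : ℕ → ℕ → Prop) : Prop :=
  ∃ h : ℕ → ℕ, Computable h ∧ ∀ x y, E x y ↔ F (h x) (h y)

/-- `E` is an equivalence relation on `ℕ` which is `Σ⁰₃`. -/
structure IsSigmaZeroThreeEquivalence (E : ℕ → ℕ → Prop) : Prop where
  equivalence : Equivalence E
  sigma : SigmaZeroThree fun p : ℕ × ℕ => E p.1 p.2

/-- `E` is a `Σ⁰₃`-complete equivalence relation: it is a `Σ⁰₃` equivalence relation on `ℕ`, and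
every `Σ⁰₃` equivalence relation on `ℕ` is computably reducible to it. -/
structure IsSigmaZeroThreeCompleteEquivalence (E : ℕ → ℕ → Prop) : Prop
    extends IsSigmaZeroThreeEquivalence E where
  hard : ∀ F : ℕ → ℕ → Prop, IsSigmaZeroThreeEquivalence F → ComputablyReducible F E

/-! ### Term algebras and presentations -/

/-- The term algebra over the set `X` of generators: the domain is the set of all terms over `X`,
and a function symbol `f` sends `t₁, …, tₙ` to the term `f(t₁, …, tₙ)`. -/
abbrev termAlgebra (L : FirstOrder.Language.{0, 0}) [L.IsAlgebraic] (X : Type) : L.Structure (L.Term X) where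
  funMap f ts := Term.func f ts
  RelMap r _ := isEmptyElim r

/-- The congruence relation on the term algebra over `X` generated by a set `R` of equations. -/
inductive Cong {L : FirstOrder.Language.{0, 0}} {X : Type} (R : Set (L.Term X × L.Term X)) :
    L.Term X → L.Term X → Prop
  | basic {s t : L.Term X} : (s, t) ∈ R → Cong R s t
  | refl (t : L.Term X) : Cong R t t
  | symm {s t : L.Term X} : Cong R s t → Cong R t s
  | trans {s t u : L.Term X} : Cong R s t → Cong R t u → Cong R s u
  | func {n : ℕ} (f : L.Functions n) (ss ts : Fin n → L.Term X) :
      (∀ i, Cong R (ss i) (ts i)) → Cong R (Term.func f ss) (Term.func f ts)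

/-- `Cong R` is contained in every congruence relation that contains `R`. -/
theorem Cong.le {L : FirstOrder.Language.{0, 0}} {X : Type} {R : Set (L.Term X × L.Term X)}
    (E : L.Term X → L.Term X → Prop) (hE : Equivalence E)
    (hf : ∀ (n : ℕ) (f : L.Functions n) (ss ts : Fin n → L.Term X),
      (∀ i, E (ss i) (ts i)) → E (Term.func f ss) (Term.func f ts))
    (hR : ∀ s t, (s, t) ∈ R → E s t) {s t : L.Term X} (h : Cong R s t) : E s t := by
  induction h with
  | basic h => exact hR _ _ h
  | refl t => exact hE.refl t
  | symm _ ih => exact hE.symm ih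
  | trans _ _ ih₁ ih₂ => exact hE.trans ih₁ ih₂
  | func f ss ts _ ih => exact hf _ f ss ts ih

/-- `Cong R` as a setoid. -/
def congSetoid {L : FirstOrder.Language.{0, 0}} {X : Type} (R : Set (L.Term X × L.Term X)) :
    Setoid (L.Term X) where
  r := Cong R
  iseqv := ⟨Cong.refl, Cong.symm, Cong.trans⟩

/-- The term algebra, together with the congruence relation generated by `R`. -/
instance congPrestructure {L : FirstOrder.Language.{0, 0}} [L.IsAlgebraic] {X : Type}
    (R : Set (L.Term X × L.Term X)) : L.Prestructure (congSetoid R) where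
  toStructure := termAlgebra L X
  fun_equiv {_ f} x y h := Cong.func f x y h
  rel_equiv {_ r} _ _ _ := isEmptyElim r

/-- The algebra presented by `⟨X, R⟩` (in the variety of all `L`-algebras): the quotient of the term
algebra over `X` by the congruence relation generated by `R`. It carries the quotient structure of
`FirstOrder.Language.quotientStructure`. -/
abbrev Presented {L : FirstOrder.Language.{0, 0}} {X : Type} (R : Set (L.Term X × L.Term X)) : Type :=
  Quotient (congSetoid R)

/-! ### Algebras with `m` unary function symbols -/

/-- Function symbols of the signature with exactly `m` function symbols, all of them unary. -/
inductive UFSymbol (m : ℕ) : ℕ → Type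
  | op : Fin m → UFSymbol m 1

/-- The signature with exactly `m` function symbols, all of them unary. -/
def UF (m : ℕ) : FirstOrder.Language.{0, 0} := ⟨UFSymbol m, fun _ => Empty⟩

instance (m : ℕ) : (UF m).IsAlgebraic := fun _ => (inferInstance : IsEmpty Empty)

/-- The coding of terms over the generators `x₀, …, xₙ₋₁`: the generator `xᵢ` has code `i`, and
`fⱼ(t)` has code `n + (m * (code of t) + j)`. -/
def codeTerm {m n : ℕ} : (UF m).Term (Fin n) → ℕ
  | .var i => i
  | .func (.op j) ts => n + (m * codeTerm (ts 0) + j)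

/-- If there is a generator and a function symbol, the coding is a bijection between terms and
natural numbers. -/
theorem codeTerm_bijective {m n : ℕ} (hm : 1 ≤ m) (hn : 1 ≤ n) :
    Function.Bijective (codeTerm : (UF m).Term (Fin n) → ℕ) := by
  constructor
  · intro s
    induction s with
    | var i =>
      intro t h
      cases t with
      | var j => simp only [codeTerm] at h; rw [Fin.ext h]
      | func f ts => cases f; simp only [codeTerm] at h; have := i.isLt; omega
    | func f ss ih =>
      intro t h
      cases f with
      | op j =>
      cases t with
      | var i => simp only [codeTerm] at h; have := i.isLt; omega
      | func f' ts =>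
        cases f' with
        | op k =>
        simp only [codeTerm] at h
        have h' : m * codeTerm (ss 0) + j = m * codeTerm (ts 0) + k := by omega
        have hj : (j : ℕ) = k := by
          have := congrArg (· % m) h'
          simpa [Nat.mul_add_mod, Nat.mod_eq_of_lt] using this
        have hc : codeTerm (ss 0) = codeTerm (ts 0) := by
          rw [hj] at h'
          exact Nat.eq_of_mul_eq_mul_left hm (by omega)
        have hst := ih 0 hc
        obtain rfl : j = k := Fin.ext hj
        obtain rfl : ss = ts := by
          funext i
          rw [Subsingleton.elim i 0, hst]
        rfl
  · intro k
    induction k using Nat.strong_induction_on with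
    | _ k ih =>
      by_cases hk : k < n
      · exact ⟨.var ⟨k, hk⟩, rfl⟩
      · obtain ⟨t, ht⟩ := ih ((k - n) / m) (lt_of_le_of_lt (Nat.div_le_self _ _) (by omega))
        refine ⟨.func (L := UF m) (.op ⟨(k - n) % m, Nat.mod_lt _ hm⟩) (fun _ => t), ?_⟩
        simp only [codeTerm, ht, Nat.div_add_mod]
        omega

/-- The set of equations between terms over `x₀, …, xₙ₋₁` that is encoded by the c.e. set `W e`;
a pair of terms is encoded by the pair of their codes. -/
def equations (m n e : ℕ) : Set ((UF m).Term (Fin n) × (UF m).Term (Fin n)) :=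
  {p | Nat.pair (codeTerm p.1) (codeTerm p.2) ∈ W e}

/-- The `e`-th `n`-generated c.e. algebra with `m` unary function symbols, `⟨x₀, …, xₙ₋₁ | W e⟩`. -/
abbrev ceAlgebra (m n e : ℕ) : Type := Presented (equations m n e)

/-- The isomorphism relation on `n`-generated c.e. algebras with `m` unary function symbols, as a
relation on indices of c.e. presentations. -/
def isoUF (m n : ℕ) (e i : ℕ) : Prop :=
  Nonempty (ceAlgebra m n e ≃[UF m] ceAlgebra m n i)

end CeAlg

/-! Upper bound. A homomorphism on a 1-generated algebra is determined by the image of the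
generator. So A_e ≅ A_i iff there are words u, v with v(u x₀) = x₀ in A_i such that, for all words
s, t, s x₀ = t x₀ in A_e iff s(u x₀) = t(u x₀) in A_i (`isoUF_iff`). Equality is Σ⁰₁
(`codeCong_iff_exists_moves`), which makes the whole condition Σ⁰₃.

Hardness. Each x is sent to the orbit of (0, 0, false) in one fixed algebra of states (d, counter,
flag), modulo a congruence depending on x; d and i are read as finite sets of binary digits. At
counter 2⟨i, l⟩ + 1 the two flags are identified iff i passes the test `Separated` at level l, or at
level l + 1 if (x ∈ i ↔ i ∈ d). The test gets harder with the level, and i passes all levels iff it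
separates two F-related numbers with witnesses bounded by i. Any other i therefore reveals whether x
∈ i agrees with i ∈ d, while an i passing all levels reveals nothing.

If F x y, all but finitely many i either treat x and y alike or pass all levels, so a finite change
D of d gives an isomorphism (`exists_translation`). Conversely, an isomorphism sends the generator
to some (d, 0, false) (`eq_of_stateCong_run_iff`). If F x y failed, the part of the F-class of x
below a large k, together with k, would be a set i outside d that tells x and y apart
(`rel_of_flagIgnored_iff`). -/

namespace CeAlg

open FirstOrder FirstOrder.Language

/-! ### Terms as words, congruence on codes -/

/-- The code of `fⱼ(t)` (with `j` read modulo `2`) in terms of the code `c` of `t`. -/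
def opCode (j c : ℕ) : ℕ := 1 + (2 * c + j % 2)

/-- The action of words on codes of terms. -/
def actCode (w : List ℕ) (c : ℕ) : ℕ := w.foldr opCode c

/-- The function symbol `fⱼ` (with `j` read modulo `2`). -/
def opSymbol (j : ℕ) : (UF 2).Functions 1 := UFSymbol.op ⟨j % 2, Nat.mod_lt _ two_pos⟩

/-- The action of words on terms. -/
def actTerm (w : List ℕ) (t : (UF 2).Term (Fin 1)) : (UF 2).Term (Fin 1) :=
  w.foldr (fun j s => Term.func (opSymbol j) fun _ => s) t

/-- The word of function symbols of a term. -/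
def wordOf : (UF 2).Term (Fin 1) → List ℕ
  | .var _ => []
  | .func (.op j) ts => (j : ℕ) :: wordOf (ts 0)

theorem codeTerm_actTerm (w : List ℕ) (t : (UF 2).Term (Fin 1)) :
    codeTerm (actTerm w t) = actCode w (codeTerm t) := by
  induction w with
  | nil => rfl
  | cons j w ih =>
    change 1 + (2 * codeTerm (actTerm w t) + j % 2) = 1 + (2 * actCode w (codeTerm t) + j % 2)
    rw [ih]

theorem exists_opSymbol {n : ℕ} (f : (UF 2).Functions n) :
    ∃ (h : 1 = n) (j : ℕ), f = h ▸ opSymbol j := by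
  cases f with
  | op j => exact ⟨rfl, j, congrArg UFSymbol.op (Fin.ext (Nat.mod_eq_of_lt j.isLt).symm)⟩

theorem wordOf_opSymbol (j : ℕ) (ts : Fin 1 → (UF 2).Term (Fin 1)) :
    wordOf (Term.func (opSymbol j) ts) = j % 2 :: wordOf (ts 0) := rfl

theorem opSymbol_mod (j : ℕ) : opSymbol (j % 2) = opSymbol j :=
  congrArg UFSymbol.op (Fin.ext (Nat.mod_mod j 2))

theorem actTerm_cons (j : ℕ) (w : List ℕ) (t : (UF 2).Term (Fin 1)) :
    actTerm (j :: w) t = Term.func (opSymbol j) fun _ => actTerm w t := rfl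

theorem actTerm_wordOf (t : (UF 2).Term (Fin 1)) : actTerm (wordOf t) (.var 0) = t := by
  induction t with
  | var i => rw [Subsingleton.elim i 0]; rfl
  | func f ts ih =>
    obtain ⟨rfl, j, rfl⟩ := exists_opSymbol f
    have h : ts = fun _ => ts 0 := funext fun i => by rw [Subsingleton.elim i 0]
    rw [wordOf_opSymbol, actTerm_cons, ih 0, ← h, opSymbol_mod]

theorem actTerm_wordOf_actTerm (w : List ℕ) (t : (UF 2).Term (Fin 1)) :
    actTerm (wordOf (actTerm w (.var 0))) t = actTerm w t := by
  induction w with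
  | nil => rfl
  | cons j w ih => rw [actTerm_cons, wordOf_opSymbol, actTerm_cons, ih, opSymbol_mod, actTerm_cons]

theorem actTerm_append (v w : List ℕ) (t : (UF 2).Term (Fin 1)) :
    actTerm (v ++ w) t = actTerm v (actTerm w t) := List.foldr_append

/-- The congruence on codes of terms that corresponds to `Cong (equations 2 1 e)`. -/
inductive CodeCong (e : ℕ) : ℕ → ℕ → Prop
  | basic {a b : ℕ} : Nat.pair a b ∈ W e → CodeCong e a b
  | refl (a : ℕ) : CodeCong e a a
  | symm {a b : ℕ} : CodeCong e a b → CodeCong e b a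
  | trans {a b c : ℕ} : CodeCong e a b → CodeCong e b c → CodeCong e a c
  | op (j : ℕ) {a b : ℕ} : CodeCong e a b → CodeCong e (opCode j a) (opCode j b)

theorem CodeCong.act {e a b : ℕ} (w : List ℕ) (h : CodeCong e a b) :
    CodeCong e (actCode w a) (actCode w b) := by
  induction w with
  | nil => exact h
  | cons j w ih => exact ih.op j

theorem cong_iff_codeCong {e : ℕ} {s t : (UF 2).Term (Fin 1)} :
    Cong (equations 2 1 e) s t ↔ CodeCong e (codeTerm s) (codeTerm t) := by
  constructor
  · intro h
    induction h with
    | basic h => exact .basic h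
    | refl t => exact .refl _
    | symm _ ih => exact ih.symm
    | trans _ _ ih₁ ih₂ => exact ih₁.trans ih₂
    | func f ss ts _ ih =>
      cases f with
      | op j =>
        have := (ih 0).op j
        rwa [opCode, opCode, Nat.mod_eq_of_lt j.isLt] at this
  · have hb := codeTerm_bijective (m := 2) (n := 1) (by norm_num) le_rfl
    suffices H : ∀ a b, CodeCong e a b → ∀ s t : (UF 2).Term (Fin 1), codeTerm s = a →
        codeTerm t = b → Cong (equations 2 1 e) s t from fun h => H _ _ h _ _ rfl rfl
    intro a b h
    induction h with
    | basic h => rintro s t rfl rfl; exact .basic h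
    | refl a =>
      rintro s t hs ht
      rw [hb.1 (hs.trans ht.symm)]
      exact .refl _
    | symm _ ih => exact fun s t hs ht => (ih t s ht hs).symm
    | trans _ _ ih₁ ih₂ =>
      intro s t hs ht
      obtain ⟨r, hr⟩ := hb.2 _
      exact (ih₁ s r hs hr).trans (ih₂ r t hr ht)
    | @op j a b _ ih =>
      intro s t hs ht
      obtain ⟨s', rfl⟩ := hb.2 a
      obtain ⟨t', rfl⟩ := hb.2 b
      have hs' : s = actTerm [j] s' := hb.1 (hs.trans (codeTerm_actTerm [j] s').symm)
      have ht' : t = actTerm [j] t' := hb.1 (ht.trans (codeTerm_actTerm [j] t').symm)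
      rw [hs', ht']
      exact .func _ _ _ fun _ => ih s' t' rfl rfl

theorem cong_actTerm_iff {e : ℕ} {s t : List ℕ} {p q : (UF 2).Term (Fin 1)} :
    Cong (equations 2 1 e) (actTerm s p) (actTerm t q) ↔
      CodeCong e (actCode s (codeTerm p)) (actCode t (codeTerm q)) := by
  rw [cong_iff_codeCong, codeTerm_actTerm, codeTerm_actTerm]

/-! ### Isomorphisms through the image of the generator -/

/-- The element of the `e`-th algebra represented by a term. -/
def ceMk (e : ℕ) (t : (UF 2).Term (Fin 1)) : ceAlgebra 2 1 e := Quotient.mk _ t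

theorem ceMk_eq_iff {e : ℕ} {s t : (UF 2).Term (Fin 1)} :
    ceMk e s = ceMk e t ↔ Cong (equations 2 1 e) s t :=
  ⟨fun h => Quotient.exact h, fun h => Quotient.sound h⟩

theorem ceMk_surjective (e : ℕ) (a : ceAlgebra 2 1 e) : ∃ w, ceMk e (actTerm w (.var 0)) = a := by
  obtain ⟨t, rfl⟩ := Quotient.exists_rep a
  exact ⟨wordOf t, congrArg _ (actTerm_wordOf t)⟩

theorem funMap_ceMk {e n : ℕ} (f : (UF 2).Functions n) (ts : Fin n → (UF 2).Term (Fin 1)) :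
    Structure.funMap f (fun i => ceMk e (ts i)) = ceMk e (Term.func f ts) :=
  funMap_quotient_mk' (s := congSetoid (equations 2 1 e)) f ts

/-- Isomorphism of the algebras with indices `e` and `i`, by means of the image `u` of the generator
and of a preimage `v` of the generator. -/
theorem isoUF_iff {e i : ℕ} : isoUF 2 1 e i ↔ ∃ u v : List ℕ,
    CodeCong i (actCode v (actCode u 0)) 0 ∧ ∀ s t : List ℕ,
      CodeCong e (actCode s 0) (actCode t 0) ↔
        CodeCong i (actCode s (actCode u 0)) (actCode t (actCode u 0)) := by
  have hcode (u : List ℕ) : codeTerm (actTerm u (.var 0)) = actCode u 0 :=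
    codeTerm_actTerm u (.var 0)
  constructor
  · rintro ⟨φ⟩
    obtain ⟨u, hu⟩ := ceMk_surjective i (φ (ceMk e (.var 0)))
    obtain ⟨v, hv⟩ := ceMk_surjective e (φ.symm (ceMk i (.var 0)))
    have key : ∀ w : List ℕ, φ (ceMk e (actTerm w (.var 0))) =
        ceMk i (actTerm w (actTerm u (.var 0))) := by
      intro w
      induction w with
      | nil => exact hu.symm
      | cons j w ih =>
        rw [actTerm_cons, actTerm_cons, ← funMap_ceMk, ← funMap_ceMk, Equiv.map_fun]
        exact congrArg _ (funext fun _ => ih)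
    refine ⟨u, v, ?_, fun s t => ?_⟩
    · have h := key v
      rw [hv, φ.apply_symm_apply] at h
      have h' := cong_iff_codeCong.1 (ceMk_eq_iff.1 h)
      rw [codeTerm_actTerm, hcode] at h'
      exact h'.symm
    · have h1 := cong_actTerm_iff (e := e) (s := s) (t := t) (p := .var 0) (q := .var 0)
      have h2 := cong_actTerm_iff (e := i) (s := s) (t := t) (p := actTerm u (.var 0))
        (q := actTerm u (.var 0))
      rw [hcode] at h2
      refine h1.symm.trans (Iff.trans ?_ h2)
      rw [← ceMk_eq_iff, ← ceMk_eq_iff, ← key, ← key, φ.injective.eq_iff]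
  · rintro ⟨u, v, hv, hst⟩
    have hst' (s t : (UF 2).Term (Fin 1)) : Cong (equations 2 1 e) s t ↔
        Cong (equations 2 1 i) (actTerm (wordOf s) (actTerm u (.var 0)))
          (actTerm (wordOf t) (actTerm u (.var 0))) := by
      rw [cong_actTerm_iff, hcode, ← hst]
      conv_lhs => rw [← actTerm_wordOf s, ← actTerm_wordOf t]
      exact cong_actTerm_iff
    let φ : ceAlgebra 2 1 e → ceAlgebra 2 1 i :=
      Quotient.lift (fun t => ceMk i (actTerm (wordOf t) (actTerm u (.var 0))))
        fun s t h => ceMk_eq_iff.2 ((hst' s t).1 h)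
    have hφ (t) : φ (ceMk e t) = ceMk i (actTerm (wordOf t) (actTerm u (.var 0))) := rfl
    have hbij : Function.Bijective φ := by
      constructor
      · rintro ⟨s⟩ ⟨t⟩ h
        exact ceMk_eq_iff.2 ((hst' s t).2 (ceMk_eq_iff.1 h))
      · intro a
        obtain ⟨w, rfl⟩ := ceMk_surjective i a
        -- Since v(u x₀) = x₀ in the target, w(v x₀) is a preimage of w x₀.
        refine ⟨ceMk e (actTerm (w ++ v) (.var 0)), ?_⟩
        rw [hφ, actTerm_wordOf_actTerm, ceMk_eq_iff, actTerm_append, cong_actTerm_iff,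
          codeTerm_actTerm, hcode]
        exact hv.act w
    refine ⟨⟨Equiv.ofBijective φ hbij, fun {n} f ts => ?_, fun {n} r => isEmptyElim r⟩⟩
    obtain ⟨rfl, j, rfl⟩ := exists_opSymbol f
    obtain ⟨w, hw⟩ := ceMk_surjective e (ts 0)
    obtain rfl : ts = fun _ => ceMk e (actTerm w (.var 0)) := funext fun k => by
      rw [Subsingleton.elim k 0, hw]
    change φ (Structure.funMap (opSymbol j) fun _ => ceMk e (actTerm w (.var 0))) =
      Structure.funMap (opSymbol j) fun _ => φ (ceMk e (actTerm w (.var 0)))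
    rw [funMap_ceMk, hφ, hφ, funMap_ceMk, ← actTerm_cons, actTerm_wordOf_actTerm,
      actTerm_wordOf_actTerm, actTerm_cons]

/-! ### Derivations as lists of moves -/

theorem opCode_injective (j : ℕ) : Function.Injective (opCode j) := fun a b h => by
  unfold opCode at h; omega

/-- A move consists of a word, a pair of codes and a number of computation steps. -/
abbrev Move : Type := List ℕ × ℕ × ℕ × ℕ

/-- If the pair of codes of the move `m` is enumerated into `W e` within the given number of steps,
then the corresponding equation is applied to `s` below the word of `m`, if possible. -/
def move (e s : ℕ) (m : Move) : ℕ :=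
  if (Nat.Partrec.Code.evaln m.2.2.2 (Denumerable.ofNat Nat.Partrec.Code e)
      (Nat.pair m.2.1 m.2.2.1)).isSome then
    if s = actCode m.1 m.2.1 then actCode m.1 m.2.2.1
    else if s = actCode m.1 m.2.2.1 then actCode m.1 m.2.1 else s
  else s

theorem mem_W_iff {e x : ℕ} : x ∈ W e ↔
    ∃ k, (Nat.Partrec.Code.evaln k (Denumerable.ofNat Nat.Partrec.Code e) x).isSome := by
  simp only [Option.isSome_iff_exists]
  refine (Part.dom_iff_mem).trans ?_
  rw [exists_comm]
  exact exists_congr fun y => Nat.Partrec.Code.evaln_complete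

/-- A move swaps its two sides and fixes everything else. Hence reversing a list of moves reverses
the derivation, which handles symmetry. -/
theorem move_move (e s : ℕ) (m : Move) : move e (move e s m) m = s := by
  unfold move
  split_ifs <;> simp_all

theorem codeCong_move (e s : ℕ) (m : Move) : CodeCong e s (move e s m) := by
  unfold move
  split_ifs with h h1 h2
  · rw [h1]; exact (CodeCong.basic (mem_W_iff.2 ⟨_, h⟩)).act _
  · rw [h2]; exact (CodeCong.basic (mem_W_iff.2 ⟨_, h⟩)).symm.act _
  · exact .refl _
  · exact .refl _

theorem move_cons (e s j : ℕ) (m : Move) :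
    move e (opCode j s) (j :: m.1, m.2) = opCode j (move e s m) := by
  have h (w : List ℕ) (c : ℕ) : actCode (j :: w) c = opCode j (actCode w c) := rfl
  simp only [move, h, (opCode_injective j).eq_iff]
  split_ifs <;> rfl

theorem codeCong_iff_exists_moves {e a b : ℕ} :
    CodeCong e a b ↔ ∃ l : List Move, l.foldl (move e) a = b := by
  constructor
  · intro h
    induction h with
    | @basic a b h =>
      obtain ⟨k, hk⟩ := mem_W_iff.1 h
      refine ⟨[([], a, b, k)], ?_⟩
      change (if _ then if a = a then b else _ else a) = b
      rw [if_pos hk, if_pos rfl]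
    | refl a => exact ⟨[], rfl⟩
    | @symm a b _ ih =>
      obtain ⟨l, rfl⟩ := ih
      refine ⟨l.reverse, ?_⟩
      clear * -
      induction l generalizing a with
      | nil => rfl
      | cons m l ih =>
        rw [List.reverse_cons, List.foldl_append, List.foldl_cons]
        change move e (l.reverse.foldl (move e) (l.foldl (move e) (move e a m))) m = a
        rw [ih, move_move]
    | trans _ _ ih₁ ih₂ =>
      obtain ⟨l₁, rfl⟩ := ih₁
      obtain ⟨l₂, rfl⟩ := ih₂
      exact ⟨l₁ ++ l₂, List.foldl_append⟩
    | @op j a b _ ih =>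
      obtain ⟨l, rfl⟩ := ih
      refine ⟨l.map fun m => (j :: m.1, m.2), ?_⟩
      rw [List.foldl_map]
      clear * -
      induction l generalizing a with
      | nil => rfl
      | cons m l ih => rw [List.foldl_cons, List.foldl_cons, move_cons, ih]
  · rintro ⟨l, rfl⟩
    induction l generalizing a with
    | nil => exact .refl _
    | cons m l ih => exact (codeCong_move e a m).trans ih

section Primrec

variable {α : Type} [Primcodable α]

theorem primrec_opCode {j c : α → ℕ} (hj : Primrec j) (hc : Primrec c) :
    Primrec fun x => opCode (j x) (c x) :=
  Primrec.nat_add.comp (.const 1) (Primrec.nat_add.comp (Primrec.nat_mul.comp (.const 2) hc)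
    (Primrec.nat_mod.comp hj (.const 2)))

theorem primrec_actCode {w : α → List ℕ} {c : α → ℕ} (hw : Primrec w) (hc : Primrec c) :
    Primrec fun x => actCode (w x) (c x) :=
  Primrec.list_foldr (h := fun _ p => opCode p.1 p.2) hw hc
    (primrec_opCode (Primrec.fst.comp .snd) (Primrec.snd.comp .snd)).to₂

theorem primrec_move {e s : α → ℕ} {m : α → Move} (he : Primrec e) (hs : Primrec s)
    (hm : Primrec m) : Primrec fun x => move (e x) (s x) (m x) := by
  have hw := Primrec.fst.comp hm
  have hp := Primrec.fst.comp (Primrec.snd.comp hm)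
  have hq := Primrec.fst.comp (Primrec.snd.comp (Primrec.snd.comp hm))
  have hk := Primrec.snd.comp (Primrec.snd.comp (Primrec.snd.comp hm))
  have hev := Nat.Partrec.Code.primrec_evaln.comp
    ((hk.pair ((Primrec.ofNat Nat.Partrec.Code).comp he)).pair (Primrec₂.natPair.comp hp hq))
  have hwp := primrec_actCode hw hp
  have hwq := primrec_actCode hw hq
  refine Primrec.ite ?_ (Primrec.ite (Primrec.eq.comp hs hwp) hwq
    (Primrec.ite (Primrec.eq.comp hs hwq) hwp hs)) hs
  exact (Primrec.eq.comp (Primrec.option_isSome.comp hev) (.const true))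

theorem primrecPred_moves {e a b : α → ℕ} {l : α → List Move} (he : Primrec e) (ha : Primrec a)
    (hb : Primrec b) (hl : Primrec l) :
    PrimrecPred fun x => (l x).foldl (move (e x)) (a x) = b x :=
  Primrec.eq.comp (Primrec.list_foldl (h := fun x p => move (e x) p.1 p.2) hl ha
    (primrec_move (he.comp .fst) (Primrec.fst.comp .snd) (Primrec.snd.comp .snd)).to₂) hb

end Primrec

/-! ### The Σ⁰₃ upper bound -/

/-- The outer witness codes u, v and a derivation of v(u x₀) = x₀. The universal number codes s, t
and a list of moves; the inner witness codes the derivations that answer it in the other algebra.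
Quantifying universally over the given derivation turns each implication between Σ⁰₁ statements into
∀∃. -/
theorem sigmaZeroThree_isoUF : SigmaZeroThree fun p : ℕ × ℕ => isoUF 2 1 p.1 p.2 := by
  let A (x : (ℕ × ℕ) × ℕ × ℕ × ℕ) := Denumerable.ofNat (List ℕ × List ℕ × List Move) x.2.1
  let B (x : (ℕ × ℕ) × ℕ × ℕ × ℕ) := Denumerable.ofNat (List ℕ × List ℕ × List Move) x.2.2.1
  let C (x : (ℕ × ℕ) × ℕ × ℕ × ℕ) := Denumerable.ofNat (List Move × List Move) x.2.2.2
  have hA : Primrec A := (Primrec.ofNat _).comp (Primrec.fst.comp .snd)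
  have hB : Primrec B := (Primrec.ofNat _).comp (Primrec.fst.comp (Primrec.snd.comp .snd))
  have hC : Primrec C := (Primrec.ofNat _).comp (Primrec.snd.comp (Primrec.snd.comp .snd))
  let P (x : (ℕ × ℕ) × ℕ × ℕ × ℕ) (l : List Move) : Prop :=
    l.foldl (move x.1.1) (actCode (B x).1 0) = actCode (B x).2.1 0
  let Q (x : (ℕ × ℕ) × ℕ × ℕ × ℕ) (l : List Move) : Prop :=
    l.foldl (move x.1.2) (actCode (B x).1 (actCode (A x).1 0)) =
      actCode (B x).2.1 (actCode (A x).1 0)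
  refine ⟨fun x => (A x).2.2.foldl (move x.1.2) (actCode (A x).2.1 (actCode (A x).1 0)) = 0 ∧
    (¬ P x (B x).2.2 ∨ Q x (C x).1) ∧ (¬ Q x (B x).2.2 ∨ P x (C x).2), ?_, ?_⟩
  · apply PrimrecPred.computablePred
    have he : Primrec fun x : (ℕ × ℕ) × ℕ × ℕ × ℕ => x.1.1 := Primrec.fst.comp .fst
    have hi : Primrec fun x : (ℕ × ℕ) × ℕ × ℕ × ℕ => x.1.2 := Primrec.snd.comp .fst
    have hu := primrec_actCode (Primrec.fst.comp hA) (.const 0)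
    have hs := Primrec.fst.comp hB
    have ht := Primrec.fst.comp (Primrec.snd.comp hB)
    have hl := Primrec.snd.comp (Primrec.snd.comp hB)
    have hP {l : (ℕ × ℕ) × ℕ × ℕ × ℕ → List Move} (hl : Primrec l) :
        PrimrecPred fun x => P x (l x) :=
      primrecPred_moves he (primrec_actCode hs (.const 0)) (primrec_actCode ht (.const 0)) hl
    have hQ {l : (ℕ × ℕ) × ℕ × ℕ × ℕ → List Move} (hl : Primrec l) :
        PrimrecPred fun x => Q x (l x) :=
      primrecPred_moves hi (primrec_actCode hs hu) (primrec_actCode ht hu) hl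
    refine (primrecPred_moves hi (primrec_actCode (Primrec.fst.comp (Primrec.snd.comp hA)) hu)
      (.const 0) (Primrec.snd.comp (Primrec.snd.comp hA))).and
      (((hP hl).not.or (hQ (Primrec.fst.comp hC))).and ((hQ hl).not.or (hP (Primrec.snd.comp hC))))
  · rintro ⟨e, i⟩
    simp only [isoUF_iff, codeCong_iff_exists_moves]
    constructor
    · rintro ⟨u, v, ⟨l, hl⟩, h⟩
      refine ⟨Encodable.encode (u, v, l), fun b => ?_⟩
      obtain ⟨⟨s, t, m⟩, rfl⟩ : ∃ b', Encodable.encode (α := List ℕ × List ℕ × List Move) b' = b :=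
        ⟨_, Denumerable.encode_ofNat b⟩
      have hst := h s t
      obtain ⟨c₁, hc₁⟩ : ∃ c₁ : List Move, ¬ m.foldl (move e) (actCode s 0) = actCode t 0 ∨
          c₁.foldl (move i) (actCode s (actCode u 0)) = actCode t (actCode u 0) := by
        by_cases hm : m.foldl (move e) (actCode s 0) = actCode t 0
        · exact (hst.1 ⟨m, hm⟩).imp fun _ => Or.inr
        · exact ⟨[], .inl hm⟩
      obtain ⟨c₂, hc₂⟩ : ∃ c₂ : List Move,
          ¬ m.foldl (move i) (actCode s (actCode u 0)) = actCode t (actCode u 0) ∨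
            c₂.foldl (move e) (actCode s 0) = actCode t 0 := by
        by_cases hm : m.foldl (move i) (actCode s (actCode u 0)) = actCode t (actCode u 0)
        · exact (hst.2 ⟨m, hm⟩).imp fun _ => Or.inr
        · exact ⟨[], .inl hm⟩
      refine ⟨Encodable.encode (c₁, c₂), ?_⟩
      simp only [A, B, C, P, Q, Denumerable.ofNat_encode]
      exact ⟨hl, hc₁, hc₂⟩
    · rintro ⟨a, ha⟩
      obtain ⟨⟨u, v, l⟩, rfl⟩ : ∃ a', Encodable.encode (α := List ℕ × List ℕ × List Move) a' = a :=
        ⟨_, Denumerable.encode_ofNat a⟩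
      have h (s t : List ℕ) (m : List Move) := ha (Encodable.encode (s, t, m))
      simp only [A, B, C, P, Q, Denumerable.ofNat_encode] at h
      refine ⟨u, v, ⟨l, (h [] [] []).choose_spec.1⟩, fun s t => ⟨?_, ?_⟩⟩
      · rintro ⟨m, hm⟩
        obtain ⟨c, -, hc, -⟩ := h s t m
        exact ⟨_, hc.resolve_left (not_not.2 hm)⟩
      · rintro ⟨m, hm⟩
        obtain ⟨c, -, -, hc⟩ := h s t m
        exact ⟨_, hc.resolve_left (not_not.2 hm)⟩

theorem equivalence_isoUF (m n : ℕ) : Equivalence (isoUF m n) where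
  refl e := ⟨FirstOrder.Language.Equiv.refl (UF m) (ceAlgebra m n e)⟩
  symm := fun ⟨φ⟩ => ⟨φ.symm⟩
  trans := fun ⟨φ⟩ ⟨ψ⟩ => ⟨ψ.comp φ⟩

/-! ### Computable predicates and uniform indices -/

section ComputablePred

variable {α β : Type} [Primcodable α] [Primcodable β]

theorem computablePred_comp {p : β → Prop} {f : α → β} (hp : ComputablePred p)
    (hf : Computable f) : ComputablePred fun a => p (f a) := by
  classical exact (hp.decide.comp hf).computablePred

theorem computablePred_and {p q : α → Prop} (hp : ComputablePred p) (hq : ComputablePred q) :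
    ComputablePred fun a => p a ∧ q a := by
  classical exact ((Primrec.and.to_comp.comp hp.decide hq.decide).of_eq fun a => by
    simp).computablePred

theorem computablePred_or {p q : α → Prop} (hp : ComputablePred p) (hq : ComputablePred q) :
    ComputablePred fun a => p a ∨ q a := by
  classical exact ((Primrec.or.to_comp.comp hp.decide hq.decide).of_eq fun a => by
    simp).computablePred

theorem computablePred_forall_lt {p : α × ℕ → Prop} {f : α → ℕ} (hp : ComputablePred p)
    (hf : Computable f) : ComputablePred fun a => ∀ b < f a, p (a, b) := by
  classical
  refine Computable.computablePred <| (Computable.nat_rec (h := fun a y => decide (p (a, y.1)) && y.2)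
    hf (Computable.const true) (Primrec.and.to_comp.comp (hp.decide.comp
      (Computable.fst.pair (Computable.fst.comp .snd))) (Computable.snd.comp .snd)).to₂).of_eq
    fun a => ?_
  induction f a with
  | zero => simp
  | succ n ih =>
    change (decide (p (a, n)) && _) = _
    rw [ih, ← Bool.decide_and]
    refine decide_eq_decide.2 ?_
    rw [Nat.forall_lt_succ_right, and_comm]

/-- Uniformly computably enumerable families of sets have computable indices. -/
theorem exists_computable_index {P : (ℕ × ℕ) × ℕ → Prop} (hP : ComputablePred P) :
    ∃ h : ℕ → ℕ, Computable h ∧ ∀ x n, n ∈ W (h x) ↔ ∃ w, P ((x, n), w) := by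
  classical
  have hψ : Partrec fun m : ℕ => Nat.rfind fun w => Part.some (decide (P (m.unpair, w))) :=
    Partrec.rfind (hP.decide.comp
      ((Primrec.unpair.to_comp.comp Computable.fst).pair Computable.snd)).partrec
  obtain ⟨c, hc⟩ := Nat.Partrec.Code.exists_code.1 (Partrec.nat_iff.1 hψ)
  refine ⟨fun x => Encodable.encode (Nat.Partrec.Code.curry c x), (Primrec.encode.comp
    (Nat.Partrec.Code.primrec₂_curry.comp (Primrec.const c) Primrec.id)).to_comp, fun x n => ?_⟩
  change (Nat.Partrec.Code.eval (Denumerable.ofNat _ (Encodable.encode _)) n).Dom ↔ _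
  rw [Denumerable.ofNat_encode, Nat.Partrec.Code.eval_curry, hc]
  refine Nat.rfind_dom.trans ?_
  simp

end ComputablePred

/-! ### The algebra of states -/

/-- Serves to show that flipping a digit, and hence `step`, is primitive recursive. -/
theorem xor_two_pow (d i : ℕ) : d ^^^ 2 ^ i = if d.testBit i then d - 2 ^ i else d + 2 ^ i := by
  induction i generalizing d with
  | zero =>
    have h1 : (d ^^^ 1) / 2 = d / 2 := by rw [Nat.xor_div_two]; simp
    have h2 : (d ^^^ 1) % 2 = (d + 1) % 2 := by
      rw [Nat.xor_mod_two_eq]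
    have h3 : d.testBit 0 = decide (d % 2 = 1) := Nat.testBit_zero d
    rw [pow_zero, h3]
    split_ifs with h <;> simp at h <;> omega
  | succ i ih =>
    have hp : 2 ^ (i + 1) = 2 * 2 ^ i := by ring
    have h1 : (d ^^^ 2 ^ (i + 1)) / 2 = (d / 2) ^^^ 2 ^ i := by
      rw [Nat.xor_div_two]; congr 1; omega
    have h2 : (d ^^^ 2 ^ (i + 1)) % 2 = d % 2 := by
      rw [Nat.xor_mod_two_eq, hp]; omega
    rw [ih] at h1
    rw [Nat.testBit_succ]
    split_ifs at h1 ⊢ with h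
    -- A set digit makes the truncated subtraction exact.
    · have := Nat.ge_two_pow_of_testBit h
      omega
    · omega

theorem primrec_two_pow : Primrec fun n : ℕ => 2 ^ n :=
  (Primrec₂.unpaired'.1 Nat.Primrec.pow).comp (.const 2) .id

theorem primrec_testBit : Primrec₂ Nat.testBit := by
  have : PrimrecPred fun p : ℕ × ℕ => p.1 / 2 ^ p.2 % 2 = 1 :=
    Primrec.eq.comp (Primrec.nat_mod.comp (Primrec.nat_div.comp .fst (primrec_two_pow.comp .snd))
      (.const 2)) (.const 1)
  exact this.decide.of_eq fun p => Nat.testBit_eq_decide_div_mod_eq.symm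

/-- States consist of a number, regarded as the set of its binary digits, a counter and a flag. -/
abbrev State : Type := ℕ × ℕ × Bool

/-- The action of the function symbols on states: odd symbols increment the counter, even symbols
reset an even counter `2 * i` and flip the digit `i`, or set the flag if the counter is odd. -/
def step (k : ℕ) (q : State) : State :=
  if k % 2 = 1 then (q.1, q.2.1 + 1, false)
  else if q.2.1 % 2 = 1 then (q.1, q.2.1, true)
  else (q.1 ^^^ 2 ^ (q.2.1 / 2), 0, false)

/-- The action of words on states. -/
def run (w : List ℕ) (q : State) : State := w.foldr step q

/-- The state reached from the initial state by the term with the given code. -/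
def stateOf : ℕ → State
  | 0 => (0, 0, false)
  | c + 1 => step c (stateOf (c / 2))

theorem stateOf_zero : stateOf 0 = (0, 0, false) := by rw [stateOf]

theorem stateOf_opCode (j c : ℕ) : stateOf (opCode j c) = step j (stateOf c) := by
  rw [opCode, Nat.add_comm, stateOf, show (2 * c + j % 2) / 2 = c by omega]
  unfold step
  rw [show (2 * c + j % 2) % 2 = j % 2 by omega]

theorem stateOf_actCode (w : List ℕ) (c : ℕ) : stateOf (actCode w c) = run w (stateOf c) := by
  induction w with
  | nil => rfl
  | cons j w ih => exact (stateOf_opCode j _).trans (congrArg _ ih)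

theorem primrec_step : Primrec₂ step := by
  have hd : Primrec fun p : ℕ × State => p.2.1 := Primrec.fst.comp .snd
  have hj : Primrec fun p : ℕ × State => p.2.2.1 := Primrec.fst.comp (Primrec.snd.comp .snd)
  have hp := primrec_two_pow.comp (Primrec.nat_div.comp hj (.const 2))
  have hx : Primrec fun p : ℕ × State => p.2.1 ^^^ 2 ^ (p.2.2.1 / 2) :=
    (Primrec.ite (Primrec.eq.comp (primrec_testBit.comp hd (Primrec.nat_div.comp hj (.const 2)))
      (.const true)) (Primrec.nat_sub.comp hd hp) (Primrec.nat_add.comp hd hp)).of_eq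
      fun p => (xor_two_pow _ _).symm
  exact Primrec.ite (Primrec.eq.comp (Primrec.nat_mod.comp .fst (.const 2)) (.const 1))
    (hd.pair ((Primrec.succ.comp hj).pair (.const false)))
    (Primrec.ite (Primrec.eq.comp (Primrec.nat_mod.comp hj (.const 2)) (.const 1))
      (hd.pair (hj.pair (.const true))) (hx.pair ((Primrec.const 0).pair (.const false))))

theorem primrec_stateOf : Primrec stateOf := by
  have h : Primrec₂ fun (_ : Unit) n => stateOf n := by
    refine Primrec.nat_strong_rec (g := fun _ l => some (Nat.casesOn l.length (0, 0, false)
      fun c => step c (l.getD (c / 2) (0, 0, false)))) _ ?_ ?_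
    · have hs : Primrec₂ fun (p : Unit × List State) c =>
          step c (p.2.getD (c / 2) (0, 0, false)) :=
        primrec_step.comp Primrec.snd ((Primrec.list_getD _).comp (Primrec.snd.comp Primrec.fst)
          (Primrec.nat_div.comp Primrec.snd (.const 2)))
      exact Primrec.option_some.comp
        (Primrec.nat_casesOn (Primrec.list_length.comp Primrec.snd) (.const _) hs)
    · intro _ n
      cases n with
      | zero => simp [stateOf]
      | succ c =>
        have : c / 2 < c + 1 := by omega
        simp [stateOf, List.getD, this]
  exact h.comp (.const ()) .id

/-! ### The congruences encoding `F` -/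

variable {R : (ℕ × ℕ) × ℕ × ℕ × ℕ → Prop} {F : ℕ → ℕ → Prop}

/-- Evidence up to `j` that the set of binary digits of `i` separates two numbers which are related
by the `Σ⁰₃` relation with matrix `R`. -/
def Separated (R : (ℕ × ℕ) × ℕ × ℕ × ℕ → Prop) (i j : ℕ) : Prop :=
  j = 0 ∨ ∃ z z' a, (a ≤ i ∧ 2 ^ (z + 1) ≤ i ∧ 2 ^ (z' + 1) ≤ i) ∧
    (i.testBit z = true ∧ i.testBit z' = false) ∧ ∀ b < j, ∃ c, R ((z, z'), a, b, c)

/-- In the presentation with parameter `x`, the flag is ignored at the number `d` and the counter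
`j`. -/
def FlagIgnored (R : (ℕ × ℕ) × ℕ × ℕ × ℕ → Prop) (x d j : ℕ) : Prop :=
  j % 2 = 1 ∧ Separated R (j / 2).unpair.1 ((j / 2).unpair.2 +
    if (j / 2).unpair.1.testBit x = d.testBit (j / 2).unpair.1 then 1 else 0)

/-- The congruence on states with parameter `x`. -/
def StateCong (R : (ℕ × ℕ) × ℕ × ℕ × ℕ → Prop) (x : ℕ) (q q' : State) : Prop :=
  q.1 = q'.1 ∧ q.2.1 = q'.2.1 ∧ (q.2.2 = q'.2.2 ∨ FlagIgnored R x q.1 q.2.1)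

theorem stateCong_equivalence (x : ℕ) : Equivalence (StateCong R x) where
  refl _ := ⟨rfl, rfl, .inl rfl⟩
  symm := by
    rintro ⟨d, j, b⟩ ⟨_, _, b'⟩ ⟨rfl, rfl, h⟩
    exact ⟨rfl, rfl, h.imp_left Eq.symm⟩
  trans := by
    rintro ⟨d, j, b⟩ ⟨_, _, b'⟩ ⟨_, _, b''⟩ ⟨rfl, rfl, h⟩ ⟨rfl, rfl, h'⟩
    refine ⟨rfl, rfl, ?_⟩
    rcases h with h | h
    · exact h'.imp_left h.trans
    · exact .inr h

/-- `step` never reads the flag, so congruent states have equal successors. -/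
theorem StateCong.step {x : ℕ} {q q' : State} (k : ℕ) (h : StateCong R x q q') :
    StateCong R x (step k q) (step k q') := by
  obtain ⟨d, j, b⟩ := q
  obtain ⟨d', j', b'⟩ := q'
  obtain ⟨rfl, rfl, -⟩ : d = d' ∧ j = j' ∧ _ := h
  exact (stateCong_equivalence x).refl _

/-- The enumerated relation is already a congruence, so generating one adds nothing. -/
theorem codeCong_iff_stateCong {e x : ℕ}
    (h : ∀ n, n ∈ W e ↔ StateCong R x (stateOf n.unpair.1) (stateOf n.unpair.2)) {a b : ℕ} :
    CodeCong e a b ↔ StateCong R x (stateOf a) (stateOf b) := by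
  constructor
  · intro hab
    induction hab with
    | basic hab => simpa using (h _).1 hab
    | refl a => exact (stateCong_equivalence x).refl _
    | symm _ ih => exact (stateCong_equivalence x).symm ih
    | trans _ _ ih₁ ih₂ => exact (stateCong_equivalence x).trans ih₁ ih₂
    | op j _ ih => rw [stateOf_opCode, stateOf_opCode]; exact ih.step j
  · exact fun hab => .basic ((h _).2 (by simpa using hab))

theorem exists_index_stateCong (hR : ComputablePred R) : ∃ h : ℕ → ℕ, Computable h ∧
    ∀ x n, n ∈ W (h x) ↔ StateCong R x (stateOf n.unpair.1) (stateOf n.unpair.2) := by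
  let V (p : (ℕ × ℕ) × ℕ) := Denumerable.ofNat (ℕ × ℕ × ℕ × List ℕ) p.2
  let q (p : (ℕ × ℕ) × ℕ) := stateOf p.1.2.unpair.1
  let q' (p : (ℕ × ℕ) × ℕ) := stateOf p.1.2.unpair.2
  let i (p : (ℕ × ℕ) × ℕ) := ((q p).2.1 / 2).unpair.1
  let j (p : (ℕ × ℕ) × ℕ) := ((q p).2.1 / 2).unpair.2 +
    if (i p).testBit p.1.1 = (q p).1.testBit (i p) then 1 else 0
  have hV : Primrec V := (Primrec.ofNat _).comp .snd
  have hq : Primrec q :=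
    primrec_stateOf.comp (Primrec.fst.comp (Primrec.unpair.comp (Primrec.snd.comp .fst)))
  have hq' : Primrec q' :=
    primrec_stateOf.comp (Primrec.snd.comp (Primrec.unpair.comp (Primrec.snd.comp .fst)))
  have hm : Primrec fun p => ((q p).2.1 / 2).unpair :=
    Primrec.unpair.comp (Primrec.nat_div.comp (Primrec.fst.comp (Primrec.snd.comp hq)) (.const 2))
  have hi : Primrec i := Primrec.fst.comp hm
  have hj : Primrec j := Primrec.nat_add.comp (Primrec.snd.comp hm) (Primrec.ite (Primrec.eq.comp
    (primrec_testBit.comp hi (Primrec.fst.comp .fst)) (primrec_testBit.comp (Primrec.fst.comp hq) hi))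
    (.const 1) (.const 0))
  have hz := Primrec.fst.comp hV
  have hz' := Primrec.fst.comp (Primrec.snd.comp hV)
  have ha := Primrec.fst.comp (Primrec.snd.comp (Primrec.snd.comp hV))
  have hL := Primrec.snd.comp (Primrec.snd.comp (Primrec.snd.comp hV))
  let P (p : (ℕ × ℕ) × ℕ) : Prop := ((q p).1 = (q' p).1 ∧ (q p).2.1 = (q' p).2.1) ∧
    ((q p).2.2 = (q' p).2.2 ∨ ((q p).2.1 % 2 = 1 ∧ (j p = 0 ∨
      ((((V p).2.2.1 ≤ i p ∧ 2 ^ ((V p).1 + 1) ≤ i p ∧ 2 ^ ((V p).2.1 + 1) ≤ i p) ∧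
      ((i p).testBit (V p).1 = true ∧ (i p).testBit (V p).2.1 = false)) ∧
      ∀ b < j p, R (((V p).1, (V p).2.1), (V p).2.2.1, b, (V p).2.2.2.getD b 0)))))
  have hP : ComputablePred P := by
    refine computablePred_and (PrimrecPred.computablePred ((Primrec.eq.comp (Primrec.fst.comp hq)
      (Primrec.fst.comp hq')).and (Primrec.eq.comp (Primrec.fst.comp (Primrec.snd.comp hq))
      (Primrec.fst.comp (Primrec.snd.comp hq'))))) (computablePred_or
      (PrimrecPred.computablePred (Primrec.eq.comp (Primrec.snd.comp (Primrec.snd.comp hq))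
      (Primrec.snd.comp (Primrec.snd.comp hq')))) (computablePred_and (PrimrecPred.computablePred
      (Primrec.eq.comp (Primrec.nat_mod.comp (Primrec.fst.comp (Primrec.snd.comp hq)) (.const 2))
      (.const 1))) (computablePred_or (PrimrecPred.computablePred (Primrec.eq.comp hj (.const 0)))
      (computablePred_and (PrimrecPred.computablePred ?_) ?_))))
    · exact ((Primrec.nat_le.comp ha hi).and ((Primrec.nat_le.comp
        (primrec_two_pow.comp (Primrec.succ.comp hz)) hi).and (Primrec.nat_le.comp
        (primrec_two_pow.comp (Primrec.succ.comp hz')) hi))).and ((Primrec.eq.comp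
        (primrec_testBit.comp hi hz) (.const true)).and (Primrec.eq.comp
        (primrec_testBit.comp hi hz') (.const false)))
    · refine computablePred_forall_lt
        (p := fun p : ((ℕ × ℕ) × ℕ) × ℕ => R (((V p.1).1, (V p.1).2.1), (V p.1).2.2.1, p.2,
          (V p.1).2.2.2.getD p.2 0)) (computablePred_comp hR (Primrec.to_comp ?_)) hj.to_comp
      exact ((hz.comp .fst).pair (hz'.comp .fst)).pair ((ha.comp .fst).pair (Primrec.snd.pair
        ((Primrec.list_getD 0).comp (hL.comp .fst) .snd)))
  obtain ⟨h, hh, hW⟩ := exists_computable_index hP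
  refine ⟨h, hh, fun x n => (hW x n).trans ⟨?_, ?_⟩⟩
  · rintro ⟨w, ⟨h1, h2⟩, h3⟩
    refine ⟨h1, h2, h3.imp_right fun h4 => ⟨h4.1, h4.2.imp_right fun h5 => ?_⟩⟩
    exact ⟨_, _, _, h5.1.1, h5.1.2, fun b hb => ⟨_, h5.2 b hb⟩⟩
  · rintro ⟨h1, h2, h3 | ⟨h3, h4 | ⟨z, z', a, h4, h5, h6⟩⟩⟩
    · exact ⟨0, ⟨h1, h2⟩, .inl h3⟩
    · exact ⟨0, ⟨h1, h2⟩, .inr ⟨h3, .inl h4⟩⟩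
    · choose! c hc using h6
      -- The list stores one witness `c b` for each `b` below the level; the level ignores the
      -- search argument, so `0` is a dummy.
      refine ⟨Encodable.encode (z, z', a, (List.range (j ((x, n), 0))).map c), ⟨h1, h2⟩,
        .inr ⟨h3, .inr ?_⟩⟩
      simp only [V, Denumerable.ofNat_encode]
      refine ⟨⟨h4, h5⟩, fun b hb => ?_⟩
      have hb' : b < j ((x, n), 0) := hb
      have := hc b hb
      simpa [List.getD, hb'] using this

/-- Pigeonhole: only finitely many triples (z, z', a) are bounded by `i`. If each failed at some
`b`, the level just above all these `b` would fail. -/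
theorem exists_forall_of_separated {i : ℕ} (h : ∀ j, Separated R i j) :
    ∃ z z', 2 ^ (z + 1) ≤ i ∧ 2 ^ (z' + 1) ≤ i ∧ i.testBit z = true ∧ i.testBit z' = false ∧
      ∃ a, ∀ b, ∃ c, R ((z, z'), a, b, c) := by
  by_contra! H
  have H' : ∀ t : ℕ × ℕ × ℕ, ∃ b, (2 ^ (t.1 + 1) ≤ i ∧ 2 ^ (t.2.1 + 1) ≤ i ∧
      i.testBit t.1 = true ∧ i.testBit t.2.1 = false) → ∀ c, ¬ R ((t.1, t.2.1), t.2.2, b, c) := by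
    intro t
    by_cases ht : 2 ^ (t.1 + 1) ≤ i ∧ 2 ^ (t.2.1 + 1) ≤ i ∧ i.testBit t.1 = true ∧
      i.testBit t.2.1 = false
    · obtain ⟨b, hb⟩ := H t.1 t.2.1 ht.1 ht.2.1 ht.2.2.1 ht.2.2.2 t.2.2
      exact ⟨b, fun _ => hb⟩
    · exact ⟨0, fun h => absurd h ht⟩
  choose b hb using H'
  let T : Finset (ℕ × ℕ × ℕ) :=
    Finset.range (i + 1) ×ˢ Finset.range (i + 1) ×ˢ Finset.range (i + 1)
  rcases h (T.sup b + 1) with h0 | ⟨z, z', a, ⟨ha, hz, hz'⟩, ⟨h1, h2⟩, h3⟩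
  · exact absurd h0 (Nat.succ_ne_zero _)
  · have hlt (y : ℕ) (hy : 2 ^ (y + 1) ≤ i) : y < i + 1 := by
      have := Nat.lt_two_pow_self (n := y + 1)
      omega
    have hT : (z, z', a) ∈ T := by
      simp only [T, Finset.mem_product, Finset.mem_range]
      exact ⟨hlt z hz, hlt z' hz', by omega⟩
    obtain ⟨c, hc⟩ := h3 (b (z, z', a)) (Nat.lt_succ_of_le (Finset.le_sup hT))
    exact hb (z, z', a) ⟨hz, hz', h1, h2⟩ c hc

theorem exists_bound_separated {x y : ℕ} (h : ∃ a, ∀ b, ∃ c, R ((x, y), a, b, c)) :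
    ∃ B, ∀ i ≥ B, i.testBit x = true → i.testBit y = false → ∀ j, Separated R i j := by
  obtain ⟨a, ha⟩ := h
  have hx := Nat.two_pow_pos (x + 1)
  have hy := Nat.two_pow_pos (y + 1)
  exact ⟨a + 2 ^ (x + 1) + 2 ^ (y + 1), fun i hi h1 h2 j =>
    .inr ⟨x, y, a, ⟨by omega, by omega, by omega⟩, ⟨h1, h2⟩, fun b _ => ha b⟩⟩

/-! ### From related numbers to isomorphic algebras -/

theorem run_cons (k : ℕ) (w : List ℕ) (q : State) : run (k :: w) q = step k (run w q) := rfl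

theorem run_append (v w : List ℕ) (q : State) : run (v ++ w) q = run v (run w q) :=
  List.foldr_append

theorem run_replicate (n d j : ℕ) : run (List.replicate n 1) (d, j, false) = (d, j + n, false) := by
  induction n with
  | zero => rfl
  | succ n ih => rw [List.replicate_succ, run_cons, ih]; rfl

/-- A set of numbers below `B` as a set of binary digits, with a word that flips these digits. -/
theorem exists_testBit_iff (p : ℕ → Prop) (B : ℕ) : ∃ (D : ℕ) (w : List ℕ),
    (∀ i, D.testBit i = true ↔ i < B ∧ p i) ∧ ∀ d, run w (d, 0, false) = (d ^^^ D, 0, false) := by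
  induction B with
  | zero => exact ⟨0, [], by simp, fun d => by rw [Nat.xor_zero]; rfl⟩
  | succ B ih =>
    obtain ⟨D, w, hD, hw⟩ := ih
    by_cases hB : p B
    -- Words act from the right: after `w` the counter is 0, then `2 * B` increments and a `0` flip
    -- digit `B`.
    · refine ⟨D ^^^ 2 ^ B, (0 :: List.replicate (2 * B) 1) ++ w, fun i => ?_, fun d => ?_⟩
      · rw [Nat.testBit_xor, Nat.testBit_two_pow]
        rcases eq_or_ne B i with rfl | hi
        · have : D.testBit B = false := by
            rw [← Bool.not_eq_true, hD]; simp
          simp [this, hB]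
        · simp only [hi, decide_false, Bool.xor_false, hD]
          have : i < B ↔ i < B + 1 := by omega
          rw [this]
      · rw [run_append, hw, run_cons, run_replicate]
        simp [step, Nat.xor_assoc]
    · refine ⟨D, w, fun i => (hD i).trans ?_, hw⟩
      refine and_congr_left fun hi => ?_
      have : i ≠ B := fun h => hB (h ▸ hi)
      omega

/-- Translation of states. -/
def translate (D : ℕ) (q : State) : State := (q.1 ^^^ D, q.2)

/-- Digits are only ever changed by xor, and the choice of case depends on the counter alone. -/
theorem run_translate (D : ℕ) (w : List ℕ) (q : State) :
    run w (translate D q) = translate D (run w q) := by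
  induction w with
  | nil => rfl
  | cons k w ih =>
    rw [run_cons, ih, run_cons]
    unfold step translate
    split_ifs
    · rfl
    · rfl
    · simp only [Nat.xor_assoc, Nat.xor_comm D]

theorem stateCong_translate_iff {D x y : ℕ}
    (h : ∀ d j, FlagIgnored R x d j ↔ FlagIgnored R y (d ^^^ D) j) (q q' : State) :
    StateCong R x q q' ↔ StateCong R y (translate D q) (translate D q') := by
  unfold StateCong translate
  rw [h, Nat.xor_left_inj]

theorem exists_translation (hF : Equivalence F)
    (hR : ∀ x y, F x y ↔ ∃ a, ∀ b, ∃ c, R ((x, y), a, b, c)) {x y : ℕ} (h : F x y) :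
    ∃ (D : ℕ) (w : List ℕ), (∀ d, run w (d, 0, false) = (d ^^^ D, 0, false)) ∧
      ∀ d j, FlagIgnored R x d j ↔ FlagIgnored R y (d ^^^ D) j := by
  obtain ⟨B₁, h₁⟩ := exists_bound_separated ((hR x y).1 h)
  obtain ⟨B₂, h₂⟩ := exists_bound_separated ((hR y x).1 (hF.symm h))
  obtain ⟨D, w, hD, hw⟩ := exists_testBit_iff (fun i => i.testBit x ≠ i.testBit y) (B₁ + B₂)
  refine ⟨D, w, hw, fun d j => and_congr_right fun _ => ?_⟩
  generalize (j / 2).unpair.1 = i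
  generalize (j / 2).unpair.2 = l
  -- Below the bound, `D` absorbs any disagreement between `x` and `y`. Above it, a disagreement
  -- makes `i` pass every level, so both sides hold.
  by_cases hi : i < B₁ + B₂
  · have hDi : D.testBit i = (i.testBit x ^^ i.testBit y) := by
      rw [Bool.eq_iff_iff, hD, and_iff_right hi]; simp
    have : (i.testBit x = d.testBit i) ↔ (i.testBit y = (d ^^^ D).testBit i) := by
      rw [Nat.testBit_xor, hDi]
      cases i.testBit x <;> cases i.testBit y <;> cases d.testBit i <;> decide
    simp only [this]
  · have hDi : D.testBit i = false := by
      rw [← Bool.not_eq_true, hD]; exact fun h => hi h.1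
    rw [Nat.testBit_xor, hDi, Bool.xor_false]
    cases hx : i.testBit x <;> cases hy : i.testBit y
    · rfl
    · have := h₂ i (by omega) hy hx
      exact iff_of_true (this _) (this _)
    · have := h₁ i (by omega) hx hy
      exact iff_of_true (this _) (this _)
    · rfl

/-! ### From isomorphic algebras to related numbers -/

/-- The initial state can only be sent to states with counter `0` and without flag. -/
theorem eq_of_stateCong_run_iff {x y : ℕ} {q : State}
    (h : ∀ s t, StateCong R x (run s (0, 0, false)) (run t (0, 0, false)) ↔
      StateCong R y (run s q) (run t q)) : ∃ d, q = (d, 0, false) := by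
  obtain ⟨d, j, b⟩ := q
  rcases Nat.mod_two_eq_zero_or_one j with hj | hj
  -- `[0, 0]` fixes the initial state by flipping digit 0 twice; from an even counter it ends at
  -- counter 0 without flag.
  · obtain ⟨-, h0, hb⟩ := (h [0, 0] []).1 (by exact (stateCong_equivalence x).refl _)
    have hq : run [0, 0] (d, j, b) = (d ^^^ 2 ^ (j / 2) ^^^ 2 ^ 0, 0, false) := by
      simp [run, step, hj]
    rw [hq] at h0 hb
    obtain rfl : 0 = j := h0
    refine ⟨d, ?_⟩
    rcases hb with hb | hb
    · obtain rfl : false = b := hb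
      rfl
    · exact absurd hb.1 (by simp)
  · exfalso
    -- From the initial state both words give counter 2, the last increment clearing the flag. From
    -- an odd `j`, the `0` resets, and the counters are 1 and `j + 2`.
    have h1 := ((h [1, 0, 1] [1, 1]).1 (by exact (stateCong_equivalence x).refl _)).2.1
    have hj' : (j + 1) % 2 = 0 := by omega
    simp [run, step, hj'] at h1

theorem rel_of_flagIgnored_iff (hF : Equivalence F)
    (hR : ∀ x y, F x y ↔ ∃ a, ∀ b, ∃ c, R ((x, y), a, b, c)) {x y d : ℕ}
    (h : ∀ j, FlagIgnored R x 0 j ↔ FlagIgnored R y d j) : F x y := by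
  by_contra hxy
  obtain ⟨k, hxk, hyk, hdk⟩ : ∃ k, x < k ∧ y < k ∧ d < k := ⟨x + y + d + 1, by omega⟩
  -- The digit `k` makes `i` too large to be a digit of `d`. The bounds `2 ^ (z + 1) ≤ i` in
  -- `Separated` exclude `z = k`, so `k` need not be related to `x`.
  obtain ⟨i, -, hi, -⟩ := exists_testBit_iff (fun z => z = k ∨ F x z) (k + 1)
  have hik : 2 ^ k ≤ i := Nat.ge_two_pow_of_testBit ((hi k).2 ⟨by omega, .inl rfl⟩)
  have hki : i < 2 ^ (k + 1) := by
    refine Nat.lt_pow_two_of_testBit i fun z hz => ?_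
    rw [← Bool.not_eq_true, hi]
    omega
  have hbit {z : ℕ} (hz : z < k) : i.testBit z = true ↔ F x z := by
    rw [hi, and_iff_right (by omega), or_iff_right hz.ne]
  have hx : i.testBit x = true := (hbit hxk).2 (hF.refl x)
  have hy : i.testBit y = false := by rwa [← Bool.not_eq_true, hbit hyk]
  have hd : d.testBit i = false := by
    refine Nat.testBit_lt_two_pow ?_
    have h1 := Nat.lt_two_pow_self (n := k)
    have h2 := Nat.lt_two_pow_self (n := i)
    omega
  have hsep : ∀ j, Separated R i j := by
    intro j
    induction j with
    | zero => exact .inl rfl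
    | succ j ih =>
      -- Here `x` is tested at level `j`, as `x` is in `i` but `i` is not in 0; `y` is tested at
      -- level `j + 1`, as both memberships fail.
      have hj := (h (2 * Nat.pair i j + 1)).1
      have hdiv : (2 * Nat.pair i j + 1) / 2 = Nat.pair i j := by omega
      simp only [FlagIgnored, hdiv, Nat.unpair_pair, hx, hy, hd, Nat.zero_testBit] at hj
      exact (hj ⟨by omega, ih⟩).2
  obtain ⟨z, z', hz, hz', hzi, hzi', hzz'⟩ := exists_forall_of_separated hsep
  have hlt {z : ℕ} (hz : 2 ^ (z + 1) ≤ i) : z < k := by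
    have := (Nat.pow_lt_pow_iff_right (by norm_num : 1 < 2)).1 (hz.trans_lt hki)
    omega
  rw [← Bool.not_eq_true, hbit (hlt hz')] at hzi'
  exact hzi' (hF.trans ((hbit (hlt hz)).1 hzi) ((hR z z').2 hzz'))

theorem computablyReducible_isoUF (hF : IsSigmaZeroThreeEquivalence F) :
    ComputablyReducible F (isoUF 2 1) := by
  obtain ⟨R, hRc, hR⟩ := hF.sigma
  replace hR (x y : ℕ) : F x y ↔ ∃ a, ∀ b, ∃ c, R ((x, y), a, b, c) := hR (x, y)
  obtain ⟨h, hh, hW⟩ := exists_index_stateCong hRc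
  refine ⟨h, hh, fun x y => ?_⟩
  simp only [isoUF_iff, codeCong_iff_stateCong (hW _), stateOf_actCode, stateOf_zero]
  constructor
  · intro hxy
    obtain ⟨D, w, hw, hD⟩ := exists_translation hF.equivalence hR hxy
    -- Xor with `D` is an involution, so the same word leads back to the generator.
    refine ⟨w, w, ?_, fun s t => ?_⟩
    · rw [hw, hw, Nat.xor_assoc, Nat.xor_self, Nat.xor_zero]
      exact (stateCong_equivalence y).refl _
    · have h0 : run w (0, 0, false) = translate D (0, 0, false) := hw 0
      rw [h0, run_translate, run_translate]
      exact stateCong_translate_iff hD _ _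
  · rintro ⟨u, -, -, hst⟩
    obtain ⟨d, hd⟩ := eq_of_stateCong_run_iff hst
    rw [hd] at hst
    refine rel_of_flagIgnored_iff hF.equivalence hR (d := d) fun j => ?_
    -- For odd `j` the two states reached differ only in the flag.
    have hj := hst (0 :: List.replicate j 1) (List.replicate j 1)
    simp only [run_cons, run_replicate, Nat.zero_add] at hj
    rcases Nat.mod_two_eq_zero_or_one j with h0 | h1
    · exact iff_of_false (fun h => absurd h.1 (by omega))
        (fun h => absurd h.1 (by omega))
    · simpa [step, h1, StateCong] using hj

end CeAlg

theorem mainTheorem2 : CeAlg.IsSigmaZeroThreeCompleteEquivalence (CeAlg.isoUF 2 1) where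
  equivalence := CeAlg.equivalence_isoUF 2 1
  sigma := CeAlg.sigmaZeroThree_isoUF
  hard _ hF := CeAlg.computablyReducible_isoUF hF
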